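/- **Theorem.** Let $n\ge 4$ and let $\mathbf C_n=(\{0,1,\dots,n-1\};\wedge,\vee,\to,\bot,\top)$ be the $n$-element Heyting chain ($0<1<\cdots<n-1$, $\bot=0$, $\top=n-1$, $a\to b=\top$ if $a\le b$ and $a\to b=b$ otherwise). Let $\mathcal G_n=\mathbb{ISP}(\mathbf C_n)$ be the class of all algebras isomorphic to a subalgebra of a power of $\mathbf C_n$, with all Heyting homomorphisms as morphisms. For $1\le i\le n-2$ let $h_i$ be the endomorphism of $\mathbf C_n$ with $h_i(x)=x+1$ if $i\le x<n-1$ and $h_i(x)=x$ otherwise. For $1\le i\le n-3$ let $g_i$ be the partial endomorphism with domain $C_n\setminus\{i\}$ given by $g_i(i+1)=i$ and $g_i(x)=x$ for $x\neq i+1$, and let $f_i\colon C_n\setminus\{i+1\}\to C_n\setminus\{i\}$ be the inverse of $g_i$. Put $$\Sigma_n=\{f_1,g_1\}\times\cdots\times\{f_{n-3},g_{n-3}\}\times\{h_1,\dots,h_{n-2}\}.$$ For $\sigma\in\Sigma_n$ consider the alter ego $(C_n;\sigma,\mathscr T)$: the set $C_n$ with the discrete topology $\mathscr T$ and with the components of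 $\sigma$ as operations and partial operations. For $\mathbf A\in\mathcal G_n$, let $D(\mathbf A)$ be the set of all homomorphisms $\mathbf A\to\mathbf C_n$, with the topology induced by the product topology on $C_n^A$ and with the components of $\sigma$ lifted pointwise (a partial operation $p$ is defined at $x\in D(\mathbf A)$ if and only if $x(a)\in\operatorname{dom}p$ for all $a\in A$). Let $ED(\mathbf A)$ be the algebra, with operations defined pointwise from $\mathbf C_n$, of all continuous maps $\varphi\colon D(\mathbf A)\to C_n$ that preserve the components of $\sigma$: $\varphi(h(x))=h(\varphi(x))$ for the total component $h$, and, for each partial component $p$, if $x\in\operatorname{dom}p$ then $\varphi(x)\in\operatorname{dom}p$ and $\varphi(p(x))=p(\varphi(x))$. Then for every $\sigma\in\Sigma_n$ the alter ego $(C_n;\sigma,\mathscr T)$ yields a duality on $\mathcal G_n$: for every $\mathbf A\in\mathcal G_n$ the evaluation map $e_{\mathbf A}\colon\mathbf A\to ED(\mathbf A)$, $e_{\mathbf A}(a)(x)=x(a)$, is an isomorphism. Each of these alter egos has exactly $n-3$ (non-total) partial endomorphisms, each of them one of the $f_i$ or $g_i$, and exactly one endomorphism, one of the $h_j$; and there are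 exactly $2^{n-3}(n-2)$ distinct alter egos of this form. -/

import Mathlib

universe u v

namespace GoedelDuality

noncomputable section

/-! The Heyting chain with `n` elements `0 < 1 < ⋯ < n - 1`. -/

/-- The `n`-element Heyting chain, with its order, its Heyting algebra structure and its discrete
topology. -/
abbrev C (n : ℕ) : Type := Fin n

section Chain

variable {n : ℕ} [NeZero n]

theorem bot_val : ((⊥ : C n) : ℕ) = 0 := by
  have h : (⊥ : C n) ≤ ⟨0, Nat.pos_of_ne_zero (NeZero.ne n)⟩ := bot_le
  have h' : ((⊥ : C n) : ℕ) ≤ 0 := h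
  omega

theorem top_val : ((⊤ : C n) : ℕ) = n - 1 := by
  have hn := Nat.pos_of_ne_zero (NeZero.ne n)
  have h : (⟨n - 1, by omega⟩ : C n) ≤ ⊤ := le_top
  have h' : n - 1 ≤ ((⊤ : C n) : ℕ) := h
  have := (⊤ : C n).isLt
  omega

/-- The implication of the chain: `a → b` is the top if `a ≤ b`, and `b` otherwise. -/
theorem himp_chain (a b : C n) : a ⇨ b = if a ≤ b then ⊤ else b := by
  split_ifs with h
  · exact himp_eq_top_iff.2 h
  · apply le_antisymm
    · rcases le_total (a ⇨ b) a with h1 | h1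
      · have := himp_inf_le (a := a) (b := b)
        rwa [inf_eq_left.2 h1] at this
      · have := himp_inf_le (a := a) (b := b)
        rw [inf_eq_right.2 h1] at this
        exact absurd this h
    · exact le_himp

end Chain

/-- `A` belongs to the quasivariety generated by the `n`-element Heyting chain: `A` is isomorphic to
a subalgebra of a power of the chain, that is, it embeds into such a power. The empty index set
(the one-element algebra) is allowed. -/
def InISP (n : ℕ) [NeZero n] (A : Type u) [HeytingAlgebra A] : Prop :=
  ∃ (I : Type u) (e : HeytingHom A (I → C n)), Function.Injective e

/-- A non-total partial endomorphism of the `n`-element chain: a homomorphism into the chain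
defined on a proper subalgebra. -/
structure PartialEnd (n : ℕ) [NeZero n] where
  /-- the domain -/
  dom : Set (C n)
  /-- the map -/
  toFun : dom → C n
  bot_mem : ⊥ ∈ dom
  top_mem : ⊤ ∈ dom
  inf_mem : ∀ {a b}, a ∈ dom → b ∈ dom → a ⊓ b ∈ dom
  sup_mem : ∀ {a b}, a ∈ dom → b ∈ dom → a ⊔ b ∈ dom
  himp_mem : ∀ {a b}, a ∈ dom → b ∈ dom → a ⇨ b ∈ dom
  map_bot : toFun ⟨⊥, bot_mem⟩ = ⊥
  map_top : toFun ⟨⊤, top_mem⟩ = ⊤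
  map_inf : ∀ a b : dom, toFun ⟨a ⊓ b, inf_mem a.2 b.2⟩ = toFun a ⊓ toFun b
  map_sup : ∀ a b : dom, toFun ⟨a ⊔ b, sup_mem a.2 b.2⟩ = toFun a ⊔ toFun b
  map_himp : ∀ a b : dom, toFun ⟨a ⇨ b, himp_mem a.2 b.2⟩ = toFun a ⇨ toFun b
  /-- the domain is not the whole chain -/
  dom_ne : dom ≠ Set.univ

/-- An alter ego `(C_n; G, H, 𝒯)`: a set `G` of endomorphisms and a set `H` of non-total partial
endomorphisms; `𝒯` is always the discrete topology. -/
@[ext]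
structure AlterEgo (n : ℕ) [NeZero n] where
  /-- the endomorphisms -/
  G : Set (HeytingHom (C n) (C n))
  /-- the non-total partial endomorphisms -/
  H : Set (PartialEnd n)

/-! Topological structures of the same type as an alter ego, and their morphisms. -/

section Structures

variable {n : ℕ} [NeZero n]

/-- A topological structure of the same type as the alter ego `M`: a topological space with a total
unary operation for each member of `G` and a partial unary operation for each member of `H`. -/
structure TopStr (M : AlterEgo n) where
  /-- the underlying set -/
  carrier : Type u
  /-- the topology -/
  top : TopologicalSpace carrier
  /-- the total operations -/
  op : M.G → carrier → carrier
  /-- the domains of the partial operations -/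
  pdom : M.H → Set carrier
  /-- the partial operations -/
  pop : (p : M.H) → pdom p → carrier

instance (M : AlterEgo n) (X : TopStr.{u} M) : TopologicalSpace X.carrier := X.top

/-- The alter ego itself, as a topological structure. -/
def AlterEgo.toTopStr (M : AlterEgo n) : TopStr.{0} M where
  carrier := C n
  top := inferInstance
  op g := g.1
  pdom p := p.1.dom
  pop p := p.1.toFun

/-- Continuous structure-preserving maps. A partial operation is preserved if its domain is mapped
into the corresponding domain and the map commutes with the operation there. -/
structure TopStr.Hom {M : AlterEgo n} (X : TopStr.{u} M) (Y : TopStr.{v} M) where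
  /-- the map -/
  toFun : X.carrier → Y.carrier
  continuous_toFun : Continuous toFun
  map_op : ∀ (g : M.G) (x : X.carrier), toFun (X.op g x) = Y.op g (toFun x)
  map_pdom : ∀ (p : M.H) (x : X.carrier), x ∈ X.pdom p → toFun x ∈ Y.pdom p
  map_pop : ∀ (p : M.H) (x : X.pdom p),
    toFun (X.pop p x) = Y.pop p ⟨toFun x, map_pdom p x x.2⟩

/-- `E(X)`: the set of morphisms from `X` to the alter ego. -/
abbrev E {M : AlterEgo n} (X : TopStr.{u} M) : Type u := X.Hom M.toTopStr

namespace E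

variable {M : AlterEgo n} {X : TopStr.{u} M}

/-- The map underlying a member of `E(X)`, with values in the chain. -/
def fn (φ : E X) : X.carrier → C n := φ.toFun

theorem fn_injective : Function.Injective (fn : E X → X.carrier → C n) := by
  rintro ⟨f, _, _, _, _⟩ ⟨g, _, _, _, _⟩ h
  have : f = g := h
  subst this
  rfl

theorem continuous_fn (φ : E X) : Continuous φ.fn := φ.continuous_toFun

theorem fn_op (φ : E X) (g : M.G) (x : X.carrier) : φ.fn (X.op g x) = g.1 (φ.fn x) :=
  φ.map_op g x

theorem fn_pdom (φ : E X) (p : M.H) (x : X.pdom p) : φ.fn x ∈ p.1.dom := φ.map_pdom p x x.2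

theorem fn_pop (φ : E X) (p : M.H) (x : X.pdom p) :
    φ.fn (X.pop p x) = p.1.toFun ⟨φ.fn x, φ.fn_pdom p x⟩ := φ.map_pop p x

/-- The operations of `E(X)` are inherited pointwise from the chain. -/
instance : Bot (E X) where
  bot :=
    { toFun := fun _ => (⊥ : C n)
      continuous_toFun := continuous_const
      map_op := fun g _ => (BotHomClass.map_bot g.1).symm
      map_pdom := fun p _ _ => p.1.bot_mem
      map_pop := fun p _ => p.1.map_bot.symm }

instance : Top (E X) where
  top :=
    { toFun := fun _ => (⊤ : C n)
      continuous_toFun := continuous_const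
      map_op := fun g _ => (TopHomClass.map_top g.1).symm
      map_pdom := fun p _ _ => p.1.top_mem
      map_pop := fun p _ => p.1.map_top.symm }

instance : Min (E X) where
  min φ ψ :=
    { toFun := fun x => (φ.fn x ⊓ ψ.fn x : C n)
      continuous_toFun := (continuous_of_discreteTopology (f := fun q : C n × C n => q.1 ⊓ q.2)).comp
        (φ.continuous_fn.prodMk ψ.continuous_fn)
      map_op := fun g x => by
        rw [fn_op, fn_op]
        have := map_inf (β := C n) g.1 (φ.fn x) (ψ.fn x)
        exact this.symm
      map_pdom := fun p x hx => p.1.inf_mem (φ.fn_pdom p ⟨x, hx⟩) (ψ.fn_pdom p ⟨x, hx⟩)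
      map_pop := fun p x => by
        rw [fn_pop, fn_pop]
        exact (p.1.map_inf ⟨_, φ.fn_pdom p x⟩ ⟨_, ψ.fn_pdom p x⟩).symm }

instance : Max (E X) where
  max φ ψ :=
    { toFun := fun x => (φ.fn x ⊔ ψ.fn x : C n)
      continuous_toFun := (continuous_of_discreteTopology (f := fun q : C n × C n => q.1 ⊔ q.2)).comp
        (φ.continuous_fn.prodMk ψ.continuous_fn)
      map_op := fun g x => by
        rw [fn_op, fn_op]
        have := map_sup (β := C n) g.1 (φ.fn x) (ψ.fn x)
        exact this.symm
      map_pdom := fun p x hx => p.1.sup_mem (φ.fn_pdom p ⟨x, hx⟩) (ψ.fn_pdom p ⟨x, hx⟩)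
      map_pop := fun p x => by
        rw [fn_pop, fn_pop]
        exact (p.1.map_sup ⟨_, φ.fn_pdom p x⟩ ⟨_, ψ.fn_pdom p x⟩).symm }

instance : HImp (E X) where
  himp φ ψ :=
    { toFun := fun x => (φ.fn x ⇨ ψ.fn x : C n)
      continuous_toFun := (continuous_of_discreteTopology (f := fun q : C n × C n => q.1 ⇨ q.2)).comp
        (φ.continuous_fn.prodMk ψ.continuous_fn)
      map_op := fun g x => by
        rw [fn_op, fn_op]
        have := map_himp (β := C n) g.1 (φ.fn x) (ψ.fn x)
        exact this.symm
      map_pdom := fun p x hx => p.1.himp_mem (φ.fn_pdom p ⟨x, hx⟩) (ψ.fn_pdom p ⟨x, hx⟩)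
      map_pop := fun p x => by
        rw [fn_pop, fn_pop]
        exact (p.1.map_himp ⟨_, φ.fn_pdom p x⟩ ⟨_, ψ.fn_pdom p x⟩).symm }

instance : Compl (E X) := ⟨fun φ => φ ⇨ ⊥⟩

instance : LE (E X) := ⟨fun φ ψ => φ.fn ≤ ψ.fn⟩

instance : LT (E X) := ⟨fun φ ψ => φ.fn < ψ.fn⟩

/-- `E(X)` is a Heyting algebra, as a subalgebra of a power of the chain. -/
instance : HeytingAlgebra (E X) :=
  Function.Injective.heytingAlgebra fn fn_injective Iff.rfl Iff.rfl (fun _ _ => rfl)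
    (fun _ _ => rfl) rfl rfl (fun φ => himp_bot φ.fn) (fun _ _ => rfl)

end E

/-- `D(A)`: the set of homomorphisms from `A` to the chain, with the topology induced by the product
topology of the `A`-th power of the chain, and with the operations and partial operations of the
alter ego lifted pointwise: a partial operation `p` is defined at `x` exactly if all values of `x`
lie in the domain of `p`. -/
def D (M : AlterEgo n) (A : Type u) [HeytingAlgebra A] : TopStr.{u} M where
  carrier := HeytingHom A (C n)
  top := TopologicalSpace.induced (fun x a => x a) (inferInstanceAs (TopologicalSpace (A → C n)))
  op g x := g.1.comp x
  pdom p := {x | ∀ a, x a ∈ p.1.dom}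
  pop p x :=
    { toFun := fun a => p.1.toFun ⟨x.1 a, x.2 a⟩
      map_sup' := fun a b => by
        rw [← p.1.map_sup ⟨x.1 a, x.2 a⟩ ⟨x.1 b, x.2 b⟩]
        congr 2
        exact map_sup x.1 a b
      map_inf' := fun a b => by
        rw [← p.1.map_inf ⟨x.1 a, x.2 a⟩ ⟨x.1 b, x.2 b⟩]
        congr 2
        exact map_inf x.1 a b
      map_bot' := by
        refine Eq.trans ?_ p.1.map_bot
        congr 2
        exact map_bot x.1
      map_himp' := fun a b => by
        rw [← p.1.map_himp ⟨x.1 a, x.2 a⟩ ⟨x.1 b, x.2 b⟩]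
        congr 2
        exact map_himp x.1 a b }

/-- The evaluation homomorphism `e_A : A → E(D(A))`, `e_A(a)(x) = x(a)`. -/
def evalHom (M : AlterEgo n) (A : Type u) [HeytingAlgebra A] : HeytingHom A (E (D M A)) where
  toFun a :=
    { toFun := fun x : HeytingHom A (C n) => x a
      continuous_toFun := (continuous_apply a).comp continuous_induced_dom
      map_op := fun _ _ => rfl
      map_pdom := fun _ _ hx => hx a
      map_pop := fun _ _ => rfl }
  map_sup' a b := E.fn_injective (funext fun x : HeytingHom A (C n) => map_sup x a b)
  map_inf' a b := E.fn_injective (funext fun x : HeytingHom A (C n) => map_inf x a b)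
  map_bot' := E.fn_injective (funext fun x : HeytingHom A (C n) => map_bot x)
  map_himp' a b := E.fn_injective (funext fun x : HeytingHom A (C n) => map_himp x a b)

/-- `M` yields a duality on the algebra `A`: the evaluation homomorphism `A → E(D(A))` is an
isomorphism. -/
def YieldsDualityOn (M : AlterEgo n) (A : Type u) [HeytingAlgebra A] : Prop :=
  Function.Bijective (evalHom M A)

/-- `M` yields a (natural) duality on the quasivariety generated by the `n`-element chain. -/
def YieldsDuality (M : AlterEgo n) : Prop :=
  ∀ (A : Type u) [HeytingAlgebra A], InISP n A → YieldsDualityOn M A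

end Structures

/-! The particular endomorphisms and partial endomorphisms. -/

section Maps

variable {n : ℕ} [NeZero n]

/-- The endomorphism `h_i`, for `1 ≤ i ≤ n - 2`: `x ↦ x + 1` if `i ≤ x < n - 1`, and `x ↦ x`
otherwise. -/
def h (i : ℕ) (hi : 1 ≤ i) (_hin : i + 2 ≤ n) : HeytingHom (C n) (C n) :=
  let F : C n → C n := fun x => if hx : i ≤ x.val ∧ x.val + 1 < n then ⟨x.val + 1, hx.2⟩ else x
  have hF : ∀ x, (F x).val = if i ≤ x.val ∧ x.val + 1 < n then x.val + 1 else x.val := by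
    intro x; simp only [F]; split_ifs <;> rfl
  have mono : Monotone F := by
    intro x y hxy
    have hxy' : x.val ≤ y.val := hxy
    have hx := x.isLt
    have hy := y.isLt
    change (F x).val ≤ (F y).val
    rw [hF, hF]
    split_ifs <;> omega
  { toFun := F
    map_sup' := fun a b => mono.map_sup a b
    map_inf' := fun a b => mono.map_inf a b
    map_bot' := by
      apply Fin.ext
      rw [hF, bot_val, if_neg (by omega)]
    map_himp' := fun a b => by
      have ha := a.isLt
      have hb := b.isLt
      rw [himp_chain, himp_chain]
      by_cases hab : a ≤ b
      · rw [if_pos hab, if_pos (mono hab)]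
        apply Fin.ext
        rw [hF, top_val, if_neg (by omega)]
      · rw [if_neg hab]
        have hab' : b.val < a.val := not_le.1 hab
        split_ifs with h2
        · have h3 : (F a).val ≤ (F b).val := h2
          apply Fin.ext
          rw [hF, hF] at h3
          rw [hF, top_val]
          split_ifs at h3 ⊢ <;> omega
        · rfl }

/-- A partial endomorphism of the chain from an injective monotone map that is defined on all
elements except one, different from the bounds, and that preserves the bounds. -/
def PartialEnd.ofMap (c : C n) (hc : c ≠ ⊥) (hc' : c ≠ ⊤) (F : C n → C n)
    (mono : ∀ x y, x ≠ c → y ≠ c → x < y → F x < F y) (hbot : F ⊥ = ⊥) (htop : F ⊤ = ⊤) :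
    PartialEnd n where
  dom := {x | x ≠ c}
  toFun x := F x.1
  bot_mem := hc.symm
  top_mem := hc'.symm
  inf_mem {a b} ha hb := by
    rcases min_choice a b with h | h
    · rw [h]; exact ha
    · rw [h]; exact hb
  sup_mem {a b} ha hb := by
    rcases max_choice a b with h | h
    · rw [h]; exact ha
    · rw [h]; exact hb
  himp_mem {a b} _ hb := by
    rw [himp_chain]
    split_ifs
    · exact hc'.symm
    · exact hb
  map_bot := hbot
  map_top := htop
  map_inf := by
    rintro ⟨a, ha⟩ ⟨b, hb⟩
    rcases lt_trichotomy a b with h | h | h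
    · simp only [inf_eq_left.2 h.le, inf_eq_left.2 (mono a b ha hb h).le]
    · subst h; simp
    · simp only [inf_eq_right.2 h.le, inf_eq_right.2 (mono b a hb ha h).le]
  map_sup := by
    rintro ⟨a, ha⟩ ⟨b, hb⟩
    rcases lt_trichotomy a b with h | h | h
    · simp only [sup_eq_right.2 h.le, sup_eq_right.2 (mono a b ha hb h).le]
    · subst h; simp
    · simp only [sup_eq_left.2 h.le, sup_eq_left.2 (mono b a hb ha h).le]
  map_himp := by
    rintro ⟨a, ha⟩ ⟨b, hb⟩
    simp only [himp_chain]
    rcases lt_trichotomy a b with h | h | h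
    · rw [if_pos h.le, if_pos (mono a b ha hb h).le, htop]
    · subst h; simp [htop]
    · rw [if_neg (not_le.2 h), if_neg (not_le.2 (mono b a hb ha h))]
  dom_ne h := by
    have : c ∈ {x : C n | x ≠ c} := h ▸ Set.mem_univ c
    exact this rfl

/-- The partial endomorphism `g_i`, for `1 ≤ i ≤ n - 3`, with domain `C_n \ {i}`: `i + 1 ↦ i`, and
`x ↦ x` otherwise. -/
def g (i : ℕ) (hi : 1 ≤ i) (hin : i + 3 ≤ n) : PartialEnd n :=
  PartialEnd.ofMap ⟨i, by omega⟩
    (fun h => by have := congrArg Fin.val h; rw [bot_val] at this; simp at this; omega)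
    (fun h => by have := congrArg Fin.val h; rw [top_val] at this; simp at this; omega)
    (fun x => if x.val = i + 1 then ⟨i, by omega⟩ else x)
    (fun x y hx hy hxy => by
      have hxy' : x.val < y.val := hxy
      have hx' : x.val ≠ i := fun h => hx (Fin.ext h)
      have hy' : y.val ≠ i := fun h => hy (Fin.ext h)
      rw [Fin.lt_def]
      split_ifs <;> simp <;> omega)
    (if_neg (by rw [bot_val]; omega)) (if_neg (by rw [top_val]; omega))

/-- The partial endomorphism `f_i`, for `1 ≤ i ≤ n - 3`, with domain `C_n \ {i + 1}`, the inverse of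
`g_i`: `i ↦ i + 1`, and `x ↦ x` otherwise. -/
def f (i : ℕ) (hi : 1 ≤ i) (hin : i + 3 ≤ n) : PartialEnd n :=
  PartialEnd.ofMap ⟨i + 1, by omega⟩
    (fun h => by have := congrArg Fin.val h; rw [bot_val] at this; simp at this)
    (fun h => by have := congrArg Fin.val h; rw [top_val] at this; simp at this; omega)
    (fun x => if x.val = i then ⟨i + 1, by omega⟩ else x)
    (fun x y hx hy hxy => by
      have hxy' : x.val < y.val := hxy
      have hx' : x.val ≠ i + 1 := fun h => hx (Fin.ext h)
      have hy' : y.val ≠ i + 1 := fun h => hy (Fin.ext h)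
      rw [Fin.lt_def]
      split_ifs <;> simp <;> omega)
    (if_neg (by rw [bot_val]; omega)) (if_neg (by rw [top_val]; omega))

variable (n) in
/-- `Σ_n = {f_1, g_1} × ⋯ × {f_{n-3}, g_{n-3}} × {h_1, …, h_{n-2}}`. The components with index
`1, …, n - 3` are listed by `Fin (n - 3)`. -/
def Sigma : Set ((Fin (n - 3) → PartialEnd n) × HeytingHom (C n) (C n)) :=
  {σ | (∀ k : Fin (n - 3),
          σ.1 k = f (k.val + 1) (by omega) (by omega) ∨
          σ.1 k = g (k.val + 1) (by omega) (by omega)) ∧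
       ∃ (j : ℕ) (hj : 1 ≤ j) (hjn : j + 2 ≤ n), σ.2 = h j hj hjn}

/-- The alter ego `(C_n; σ, 𝒯)`, whose operations and partial operations are the components
of `σ`. -/
def alterEgo (σ : (Fin (n - 3) → PartialEnd n) × HeytingHom (C n) (C n)) : AlterEgo n where
  G := {σ.2}
  H := Set.range σ.1

end Maps

end

end GoedelDuality

/-!
`D(A)` is compact, so by a lattice form of the Stone–Weierstrass theorem a member `φ` of `ED(A)` is
an evaluation as soon as for all `x`, `y` some `a ∈ A` satisfies `φ x ≤ x a` and `y a ≤ φ y`. If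
there is no such `a`, modus ponens in `A` produces a prime filter of the form
`{a | i ≤ x a} = {a | j ≤ y a}` with `i ≤ φ x` and `φ y < j`, and this is impossible if `φ`
preserves the relation `i ≤ u ↔ j ≤ v` of the chain.

It remains to derive this relation from `σ`. The graph of `f_i` is the converse of that of `g_i`,
and composing with these graphs turns any `h_j` into any other. Compositions of the `h_j` shift
level `i` to the top, which leaves the relation `u = ⊤ ↔ v = ⊤`. Finally, the maps `g_i` compress a
homomorphism `A → C_n` to one without gaps in its range, which is determined by its preimage of `⊤`.
-/

namespace GoedelDuality

open scoped SetRel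

section Approximation

variable {X L : Type*} [TopologicalSpace X] [CompactSpace X] [TopologicalSpace L]
  [DiscreteTopology L]

theorem exists_le_of_infClosed [SemilatticeInf L] {S : Set (X → L)} (hS : InfClosed S)
    (hne : S.Nonempty) (hcont : ∀ s ∈ S, Continuous s) {φ : X → L} (hφ : Continuous φ)
    (hle : ∀ x, ∃ s ∈ S, s x ≤ φ x) : ∃ s ∈ S, s ≤ φ := by
  suffices ∃ s ∈ S, ∀ x ∈ Set.univ, s x ≤ φ x by simpa only [Set.mem_univ, true_imp_iff]
  refine isCompact_univ.induction_on (p := fun U => ∃ s ∈ S, ∀ x ∈ U, s x ≤ φ x)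
    ?_ ?_ ?_ fun x _ => ?_
  · exact hne.imp fun s hs => ⟨hs, fun x hx => hx.elim⟩
  · rintro U V hUV ⟨s, hs, hsV⟩
    exact ⟨s, hs, fun x hx => hsV x (hUV hx)⟩
  · rintro U V ⟨s, hs, hsU⟩ ⟨t, ht, htV⟩
    refine ⟨s ⊓ t, hS hs ht, ?_⟩
    rintro x (hx | hx)
    · exact inf_le_left.trans (hsU x hx)
    · exact inf_le_right.trans (htV x hx)
  · obtain ⟨s, hs, hsx⟩ := hle x
    have hopen : IsOpen {z | s z ≤ φ z} :=
      (isOpen_discrete {q : L × L | q.1 ≤ q.2}).preimage ((hcont s hs).prodMk hφ)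
    exact ⟨_, mem_nhdsWithin_of_mem_nhds (hopen.mem_nhds hsx), s, hs, fun _ => id⟩

/-- Over a discrete lattice, the lattice form of the Stone–Weierstrass theorem needs no limits. -/
theorem mem_of_forall_exists_le_and_le [Lattice L] {S : Set (X → L)} (hS : IsSublattice S)
    (hne : S.Nonempty) (hcont : ∀ s ∈ S, Continuous s) {φ : X → L} (hφ : Continuous φ)
    (hφS : ∀ x y, ∃ s ∈ S, φ x ≤ s x ∧ s y ≤ φ y) : φ ∈ S := by
  have below (x : X) : ∃ s ∈ {s ∈ S | φ x ≤ s x}, s ≤ φ := by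
    refine exists_le_of_infClosed ?_ ?_ (fun s hs => hcont s hs.1) hφ fun y => ?_
    · exact fun s hs t ht => ⟨hS.infClosed hs.1 ht.1, le_inf hs.2 ht.2⟩
    · obtain ⟨s, hs, hxs, -⟩ := hφS x x
      exact ⟨s, hs, hxs⟩
    · obtain ⟨s, hs, hxs, hsy⟩ := hφS x y
      exact ⟨s, ⟨hs, hxs⟩, hsy⟩
  obtain ⟨s, ⟨hs, hsφ⟩, hφs⟩ : ∃ s ∈ {s ∈ S | s ≤ φ}, φ ≤ s := by
    refine exists_le_of_infClosed (L := Lᵒᵈ) ?_ ?_ (fun s hs => hcont s hs.1) hφ fun x => ?_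
    · exact fun s hs t ht => ⟨hS.supClosed hs.1 ht.1, sup_le hs.2 ht.2⟩
    · cases isEmpty_or_nonempty X with
      | inl _ => exact hne.imp fun s hs => ⟨hs, isEmptyElim⟩
      | inr hX => exact (below hX.some).imp fun s hs => ⟨hs.1.1, hs.2⟩
    · obtain ⟨s, ⟨hs, hxs⟩, hsφ⟩ := below x
      exact ⟨s, ⟨hs, hsφ⟩, hxs⟩
  rwa [← hsφ.antisymm hφs]

end Approximation

section HomSpace

theorem isClosed_range_coe_heytingHom {A L : Type*} [HeytingAlgebra A] [HeytingAlgebra L]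
    [TopologicalSpace L] [DiscreteTopology L] :
    IsClosed (Set.range ((⇑) : HeytingHom A L → A → L)) := by
  have isClosed_map₂ (op : A → A → A) (op' : L → L → L) :
      IsClosed {p : A → L | ∀ a b, p (op a b) = op' (p a) (p b)} := by
    simp only [Set.ofPred_forall]
    refine isClosed_iInter fun a => isClosed_iInter fun b => isClosed_eq (continuous_apply _) ?_
    exact (continuous_of_discreteTopology (f := fun q : L × L => op' q.1 q.2)).comp
      ((continuous_apply (A := fun _ : A => L) a).prodMk (continuous_apply b))
  have range_eq : Set.range ((⇑) : HeytingHom A L → A → L) =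
      {p | p ⊥ = ⊥} ∩ {p | ∀ a b, p (a ⊔ b) = p a ⊔ p b} ∩
        {p | ∀ a b, p (a ⊓ b) = p a ⊓ p b} ∩ {p | ∀ a b, p (a ⇨ b) = p a ⇨ p b} := by
    ext p
    constructor
    · rintro ⟨x, rfl⟩
      exact ⟨⟨⟨map_bot x, map_sup x⟩, map_inf x⟩, map_himp x⟩
    · rintro ⟨⟨⟨hbot, hsup⟩, hinf⟩, hhimp⟩
      exact ⟨⟨⟨⟨p, hsup⟩, hinf⟩, hbot, hhimp⟩, rfl⟩
  rw [range_eq]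
  exact (((isClosed_eq (continuous_apply _) continuous_const).inter (isClosed_map₂ _ _)).inter
    (isClosed_map₂ _ _)).inter (isClosed_map₂ _ _)

variable {n : ℕ} [NeZero n] {A : Type u} [HeytingAlgebra A]

instance (M : AlterEgo n) : CompactSpace (D M A).carrier :=
  Topology.IsClosedEmbedding.compactSpace (f := ((⇑) : HeytingHom A (C n) → A → C n))
    ⟨⟨⟨rfl⟩, DFunLike.coe_injective (F := HeytingHom A (C n))⟩, isClosed_range_coe_heytingHom⟩

theorem evalHom_injective (M : AlterEgo n) (hA : InISP n A) :
    Function.Injective (evalHom M A) := by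
  obtain ⟨I, e, he⟩ := hA
  intro a b hab
  refine he (funext fun k => ?_)
  let coord : HeytingHom A (C n) :=
    { toFun := fun a => e a k
      map_sup' := fun a b => congrFun (map_sup e a b) k
      map_inf' := fun a b => congrFun (map_inf e a b) k
      map_bot' := congrFun (map_bot e) k
      map_himp' := fun a b => congrFun (map_himp e a b) k }
  exact congrFun (congrArg E.fn hab) coord

theorem mem_range_evalHom {M : AlterEgo n} (φ : E (D M A))
    (hφ : ∀ x y : HeytingHom A (C n), ∃ a, φ.fn x ≤ x a ∧ y a ≤ φ.fn y) :
    φ ∈ Set.range (evalHom M A) := by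
  have hmem : φ.fn ∈ Set.range (E.fn ∘ evalHom M A) := by
    refine mem_of_forall_exists_le_and_le ⟨?_, ?_⟩ (Set.range_nonempty _) ?_ φ.continuous_fn ?_
    · rintro _ ⟨a, rfl⟩ _ ⟨b, rfl⟩
      exact ⟨a ⊔ b, congrArg E.fn (map_sup (evalHom M A) a b)⟩
    · rintro _ ⟨a, rfl⟩ _ ⟨b, rfl⟩
      exact ⟨a ⊓ b, congrArg E.fn (map_inf (evalHom M A) a b)⟩
    · rintro _ ⟨a, rfl⟩
      exact (evalHom M A a).continuous_fn
    · exact fun x y => (hφ x y).elim fun a ha => ⟨_, ⟨a, rfl⟩, ha⟩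
  obtain ⟨a, ha⟩ := hmem
  exact ⟨a, E.fn_injective ha⟩

end HomSpace

section Graphs

variable {n : ℕ} [NeZero n]

/-- The graph of a partial endomorphism, as a relation on the whole chain. -/
def PartialEnd.graph (p : PartialEnd n) : SetRel (C n) (C n) :=
  {q | ∃ hq : q.1 ∈ p.dom, p.toFun ⟨q.1, hq⟩ = q.2}

theorem PartialEnd.exists_forall_mem_graph {A : Type u} [HeytingAlgebra A] (p : PartialEnd n)
    {x : HeytingHom A (C n)} (hx : ∀ a, x a ∈ p.dom) :
    ∃ y : HeytingHom A (C n), ∀ a, x a ~[p.graph] y a :=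
  ⟨(D ⟨∅, {p}⟩ A).pop ⟨p, rfl⟩ ⟨x, hx⟩, fun a => ⟨hx a, rfl⟩⟩

theorem h_apply_val (j : ℕ) (hj : 1 ≤ j) (hjn : j + 2 ≤ n) (u : C n) :
    (h j hj hjn u).val = if j ≤ u.val ∧ u.val + 1 < n then u.val + 1 else u.val := by
  change (dite _ _ _ : C n).val = _
  split_ifs <;> rfl

theorem PartialEnd.mem_graph_ofMap {c : C n} {hc : c ≠ ⊥} {hc' : c ≠ ⊤} {F : C n → C n}
    {mono : ∀ x y, x ≠ c → y ≠ c → x < y → F x < F y} {hbot : F ⊥ = ⊥} {htop : F ⊤ = ⊤}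
    {u v : C n} : u ~[(ofMap c hc hc' F mono hbot htop).graph] v ↔ u ≠ c ∧ F u = v :=
  ⟨fun ⟨hu, huv⟩ => ⟨hu, huv⟩, fun ⟨hu, huv⟩ => ⟨hu, huv⟩⟩

theorem mem_graph_g {i : ℕ} {hi : 1 ≤ i} {hin : i + 3 ≤ n} {u v : C n} :
    u ~[(g i hi hin).graph] v ↔ u.val ≠ i ∧ v.val = if u.val = i + 1 then i else u.val := by
  rw [g, PartialEnd.mem_graph_ofMap, ne_eq, Fin.ext_iff, Fin.ext_iff, apply_ite Fin.val,
    eq_comm (b := v.val)]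

theorem mem_graph_f {i : ℕ} {hi : 1 ≤ i} {hin : i + 3 ≤ n} {u v : C n} :
    u ~[(f i hi hin).graph] v ↔ u.val ≠ i + 1 ∧ v.val = if u.val = i then i + 1 else u.val := by
  rw [f, PartialEnd.mem_graph_ofMap, ne_eq, Fin.ext_iff, Fin.ext_iff, apply_ite Fin.val,
    eq_comm (b := v.val)]

theorem eq_top_iff_of_mem_graph_g {i : ℕ} {hi : 1 ≤ i} {hin : i + 3 ≤ n} {u v : C n}
    (huv : u ~[(g i hi hin).graph] v) : u = ⊤ ↔ v = ⊤ := by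
  rw [mem_graph_g] at huv
  rw [Fin.ext_iff, Fin.ext_iff, top_val]
  grind

theorem graph_f {i : ℕ} (hi : 1 ≤ i) (hin : i + 3 ≤ n) :
    (f i hi hin).graph = (g i hi hin).graph.inv := by
  ext ⟨u, v⟩
  rw [SetRel.mem_inv, mem_graph_f, mem_graph_g]
  grind

theorem graph_h_succ {j : ℕ} (hj : 1 ≤ j) (hjn : j + 3 ≤ n) :
    Function.graph (h (n := n) (j + 1) (by omega) (by omega)) =
      Function.graph (h j hj (by omega)) ○ (g j hj hjn).graph := by
  ext ⟨u, v⟩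
  simp only [SetRel.mem_comp, Function.mem_graph, exists_eq_left']
  simp only [mem_graph_g, Fin.ext_iff, h_apply_val]
  grind

theorem graph_h_eq_comp_graph_f {j : ℕ} (hj : 1 ≤ j) (hjn : j + 3 ≤ n) :
    Function.graph (h (n := n) j hj (by omega)) =
      Function.graph (h (j + 1) (by omega) (by omega)) ○ (f j hj hjn).graph := by
  ext ⟨u, v⟩
  simp only [SetRel.mem_comp, Function.mem_graph, exists_eq_left']
  simp only [mem_graph_f, Fin.ext_iff, h_apply_val]
  grind

end Graphs

section Entailment

variable {n : ℕ} [NeZero n] {A : Type u} [HeytingAlgebra A] {ψ : HeytingHom A (C n) → C n}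

/-- The map `ψ` preserves the binary relation `R` of the chain, lifted pointwise to the set of
homomorphisms `A → C_n`. An operation or partial operation is preserved if its graph is. -/
def Preserves (ψ : HeytingHom A (C n) → C n) (R : SetRel (C n) (C n)) : Prop :=
  ∀ ⦃x y : HeytingHom A (C n)⦄, (∀ a, x a ~[R] y a) → ψ x ~[R] ψ y

theorem preserves_graph_of_mem_G {M : AlterEgo n} (φ : E (D M A)) {e : HeytingHom (C n) (C n)}
    (he : e ∈ M.G) : Preserves φ.fn (Function.graph e) := by
  intro x y hxy
  obtain rfl : e.comp x = y := DFunLike.ext _ _ hxy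
  exact (φ.fn_op ⟨e, he⟩ x).symm

theorem preserves_graph_of_mem_H {M : AlterEgo n} (φ : E (D M A)) {p : PartialEnd n}
    (hp : p ∈ M.H) : Preserves φ.fn p.graph := by
  intro x y hxy
  have hx : x ∈ (D M A).pdom ⟨p, hp⟩ := fun a => (hxy a).1
  obtain rfl : (D M A).pop ⟨p, hp⟩ ⟨x, hx⟩ = y :=
    DFunLike.ext (F := HeytingHom A (C n)) _ _ fun a => (hxy a).2
  exact ⟨φ.fn_pdom ⟨p, hp⟩ ⟨x, hx⟩, (φ.fn_pop ⟨p, hp⟩ ⟨x, hx⟩).symm⟩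

theorem Preserves.inv {R : SetRel (C n) (C n)} (hR : Preserves ψ R) : Preserves ψ R.inv :=
  fun _ _ hxy => hR hxy

theorem Preserves.graph_comp {e : HeytingHom (C n) (C n)} {R : SetRel (C n) (C n)}
    (he : Preserves ψ (Function.graph e)) (hR : Preserves ψ R) :
    Preserves ψ (Function.graph e ○ R) := by
  intro x y hxy
  refine ⟨ψ (e.comp x), he fun a => rfl, hR fun a => ?_⟩
  obtain ⟨_, rfl, hR⟩ := hxy a
  exact hR

theorem preserves_graph_g_of_mem {M : AlterEgo n} (φ : E (D M A)) {i : ℕ} {hi : 1 ≤ i}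
    {hin : i + 3 ≤ n} (hM : f i hi hin ∈ M.H ∨ g i hi hin ∈ M.H) :
    Preserves φ.fn (g i hi hin).graph := by
  rcases hM with hf | hg
  · have := (preserves_graph_of_mem_H φ hf).inv
    rwa [graph_f, SetRel.inv_inv] at this
  · exact preserves_graph_of_mem_H φ hg

theorem preserves_graph_h_succ_iff {j : ℕ} (hj : 1 ≤ j) (hjn : j + 3 ≤ n)
    (hg : Preserves ψ (g j hj hjn).graph) :
    Preserves ψ (Function.graph (h (j + 1) (by omega) (by omega))) ↔
      Preserves ψ (Function.graph (h j hj (by omega))) := by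
  constructor <;> intro hh
  · rw [graph_h_eq_comp_graph_f hj hjn, graph_f]
    exact hh.graph_comp hg.inv
  · rw [graph_h_succ hj hjn]
    exact hh.graph_comp hg

theorem preserves_graph_h_iff_one
    (hg : ∀ i (hi : 1 ≤ i) (hin : i + 3 ≤ n), Preserves ψ (g i hi hin).graph)
    {j : ℕ} (hj : 1 ≤ j) (hjn : j + 2 ≤ n) :
    Preserves ψ (Function.graph (h j hj hjn)) ↔
      Preserves ψ (Function.graph (h 1 le_rfl (by omega))) := by
  induction j, hj using Nat.le_induction with
  | base => rfl
  | succ k hk ih => exact (preserves_graph_h_succ_iff hk hjn (hg k hk hjn)).trans (ih (by omega))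

theorem exists_preserves_graph_and_eq_top_iff
    (hh : ∀ j (hj : 1 ≤ j) (hjn : j + 2 ≤ n), Preserves ψ (Function.graph (h j hj hjn)))
    {i : ℕ} (hi : 1 ≤ i) (hin : i ≤ n - 1) :
    ∃ e : HeytingHom (C n) (C n), Preserves ψ (Function.graph e) ∧ ∀ v, e v = ⊤ ↔ i ≤ v.val := by
  induction hin using Nat.decreasingInduction with
  | self =>
    refine ⟨.id _, fun x y hxy => congrArg ψ (DFunLike.ext _ _ hxy), fun v => ?_⟩
    rw [HeytingHom.id_apply, Fin.ext_iff, top_val]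
    omega
  | of_succ i hin ih =>
    obtain ⟨e, he, he_top⟩ := ih (by omega)
    refine ⟨e.comp (h i hi (by omega)), ?_, fun v => ?_⟩
    · rw [HeytingHom.coe_comp, Function.graph_comp]
      exact (hh i hi (by omega)).graph_comp he
    · rw [HeytingHom.comp_apply, he_top, h_apply_val]
      grind

end Entailment

section Interpolation

variable {n : ℕ} [NeZero n] {A : Type u} [HeytingAlgebra A] {ψ : HeytingHom A (C n) → C n}

theorem map_le_map_iff_of_eq_top_iff {L : Type*} [HeytingAlgebra L] {x y : HeytingHom A L}
    (hxy : ∀ a, x a = ⊤ ↔ y a = ⊤) (a b : A) : x a ≤ x b ↔ y a ≤ y b := by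
  rw [← himp_eq_top_iff, ← map_himp, hxy, map_himp, himp_eq_top_iff]

/-- The range of `x` has no gap below any of its elements other than the top: it is an initial
segment of the chain together with the top. -/
def IsCompressed (x : HeytingHom A (C n)) : Prop :=
  ∀ i, i + 3 ≤ n → (∃ a, (x a).val = i + 1) → ∃ a, (x a).val = i

theorem IsCompressed.le {x y : HeytingHom A (C n)} (hx : IsCompressed x)
    (hxy : ∀ a, x a = ⊤ ↔ y a = ⊤) : x ≤ y := by
  suffices ∀ i a, (x a).val = i → i ≤ (y a).val from fun a => this _ a rfl
  intro i
  induction i with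
  | zero => exact fun _ _ => Nat.zero_le _
  | succ i ih =>
    intro a ha
    by_cases htop : x a = ⊤
    · rw [(hxy a).1 htop, ← htop, ha]
    · have hi : i + 3 ≤ n := by
        rw [Fin.ext_iff, top_val] at htop
        omega
      obtain ⟨b, hb⟩ := hx i hi ⟨a, ha⟩
      have hba : y b < y a := by
        rw [← not_le, ← map_le_map_iff_of_eq_top_iff hxy, not_le, Fin.lt_def]
        omega
      exact (ih b hb).trans_lt hba

theorem exists_comp_of_not_isCompressed
    (hg : ∀ i (hi : 1 ≤ i) (hin : i + 3 ≤ n), Preserves ψ (g i hi hin).graph)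
    {x : HeytingHom A (C n)} (hx : ¬ IsCompressed x) :
    ∃ (r : C n → C n) (y : HeytingHom A (C n)), r ≤ id ∧ ⇑y = r ∘ x ∧ y ≠ x ∧
      (∀ a, x a = ⊤ ↔ y a = ⊤) ∧ (ψ x = ⊤ ↔ ψ y = ⊤) := by
  simp only [IsCompressed, not_forall, not_exists] at hx
  obtain ⟨i, hin, ⟨a, ha⟩, hgap⟩ := hx
  have hi : 1 ≤ i := by
    have := hgap ⊥
    rw [map_bot, bot_val] at this
    omega
  obtain ⟨y, hy⟩ := (g i hi hin).exists_forall_mem_graph (x := x)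
    fun b hb => hgap b (congrArg Fin.val hb)
  have y_val (b) : (y b).val = if (x b).val = i + 1 then i else (x b).val :=
    (mem_graph_g.1 (hy b)).2
  let r : C n → C n := fun v => if v.val = i + 1 then ⟨i, by omega⟩ else v
  have r_val (v) : (r v).val = if v.val = i + 1 then i else v.val := apply_ite Fin.val _ _ _
  refine ⟨r, y, fun v => ?_, funext fun b => Fin.ext ((y_val b).trans (r_val _).symm),
    fun hyx => ?_, fun b => eq_top_iff_of_mem_graph_g (hy b),
    eq_top_iff_of_mem_graph_g (hg i hi hin hy)⟩
  · rw [Fin.le_def, r_val, id_eq]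
    split_ifs <;> omega
  · have := y_val a
    rw [hyx, if_pos ha, ha] at this
    omega

theorem exists_isCompressed
    (hg : ∀ i (hi : 1 ≤ i) (hin : i + 3 ≤ n), Preserves ψ (g i hi hin).graph)
    (x : HeytingHom A (C n)) :
    ∃ y, IsCompressed y ∧ (∀ a, x a = ⊤ ↔ y a = ⊤) ∧ (ψ x = ⊤ ↔ ψ y = ⊤) := by
  let P (k : C n → C n) : Prop := ∃ y : HeytingHom A (C n),
    ⇑y = k ∘ x ∧ (∀ a, x a = ⊤ ↔ y a = ⊤) ∧ (ψ x = ⊤ ↔ ψ y = ⊤)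
  obtain ⟨k, ⟨y, hyk, hy, hψy⟩, hmin⟩ : ∃ k, Minimal P k :=
    exists_minimal_of_wellFoundedLT P ⟨id, x, rfl, fun _ => Iff.rfl, Iff.rfl⟩
  refine ⟨y, ?_, hy, hψy⟩
  by_contra hcompressed
  obtain ⟨r, z, hr, hzr, hne, hz, hψz⟩ := exists_comp_of_not_isCompressed hg hcompressed
  have hrk : r ∘ k ≤ k := fun v => hr (k v)
  have hP : P (r ∘ k) :=
    ⟨z, by rw [hzr, hyk, Function.comp_assoc], fun a => (hy a).trans (hz a), hψy.trans hψz⟩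
  have hrk_eq : r ∘ k = k := hrk.antisymm (hmin hP hrk)
  exact hne (DFunLike.coe_injective (by rw [hzr, hyk, ← Function.comp_assoc, hrk_eq]))

theorem preserves_eq_top_iff
    (hg : ∀ i (hi : 1 ≤ i) (hin : i + 3 ≤ n), Preserves ψ (g i hi hin).graph) :
    Preserves ψ {q | q.1 = ⊤ ↔ q.2 = ⊤} := by
  intro x y hxy
  obtain ⟨x', hx', hxx', hψx⟩ := exists_isCompressed hg x
  obtain ⟨y', hy', hyy', hψy⟩ := exists_isCompressed hg y
  have htop (a) : x' a = ⊤ ↔ y' a = ⊤ := (hxx' a).symm.trans ((hxy a).trans (hyy' a))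
  obtain rfl : x' = y' := (hx'.le htop).antisymm (hy'.le fun a => (htop a).symm)
  exact hψx.trans hψy.symm

theorem preserves_le_iff_le
    (hg : ∀ i (hi : 1 ≤ i) (hin : i + 3 ≤ n), Preserves ψ (g i hi hin).graph)
    (hh : ∀ j (hj : 1 ≤ j) (hjn : j + 2 ≤ n), Preserves ψ (Function.graph (h j hj hjn)))
    {i j : ℕ} (hi : 1 ≤ i) (hin : i ≤ n - 1) (hj : 1 ≤ j) (hjn : j ≤ n - 1) :
    Preserves ψ {q | i ≤ q.1.val ↔ j ≤ q.2.val} := by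
  obtain ⟨e, he, he_top⟩ := exists_preserves_graph_and_eq_top_iff hh hi hin
  obtain ⟨e', he', he'_top⟩ := exists_preserves_graph_and_eq_top_iff hh hj hjn
  intro x y hxy
  have hψx : e (ψ x) = ψ (e.comp x) := he fun _ => rfl
  have hψy : e' (ψ y) = ψ (e'.comp y) := he' fun _ => rfl
  change i ≤ (ψ x).val ↔ j ≤ (ψ y).val
  rw [← he_top, ← he'_top, hψx, hψy]
  refine preserves_eq_top_iff hg fun a => ?_
  change e (x a) = ⊤ ↔ e' (y a) = ⊤
  rw [he_top, he'_top]
  exact hxy a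

theorem exists_le_apply_and_apply_le
    (hψ : ∀ {i j : ℕ}, 1 ≤ i → i ≤ n - 1 → 1 ≤ j → j ≤ n - 1 →
      Preserves ψ {q | i ≤ q.1.val ↔ j ≤ q.2.val})
    (x y : HeytingHom A (C n)) : ∃ a, ψ x ≤ x a ∧ y a ≤ ψ y := by
  by_contra! hcontra
  obtain ⟨i, hi, hi'⟩ : ∃ i, ¬ (∀ a, i ≤ (x a).val → ψ y < y a) ∧
      ∀ a, i + 1 ≤ (x a).val → ψ y < y a := by
    refine Nat.exists_not_and_succ_of_not_zero_of_exists (fun h0 => ?_) ⟨_, hcontra⟩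
    exact not_lt_bot (map_bot y ▸ h0 ⊥ (Nat.zero_le _))
  push Not at hi
  obtain ⟨d, hd, hyd⟩ := hi
  have hiψ : i + 1 ≤ (ψ x).val := by
    by_contra! hlt
    exact (hcontra d ((Nat.lt_succ_iff.1 hlt).trans hd)).not_ge hyd
  have hψy : (ψ y).val + 1 ≤ n - 1 := by
    have := hcontra ⊤ (by rw [map_top]; exact le_top)
    rw [map_top, Fin.lt_def, top_val] at this
    exact this
  have same_filter (c) : i + 1 ≤ (x c).val ↔ (ψ y).val + 1 ≤ (y c).val := by
    refine ⟨hi' c, fun hc => ?_⟩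
    by_contra! hlt
    have hcd : x (c ⇨ d) = ⊤ := by
      rw [map_himp, himp_eq_top_iff]
      exact (Nat.lt_succ_iff.1 hlt).trans hd
    have lt_himp : ψ y < y (c ⇨ d) := hi' _ (by rw [hcd, top_val]; omega)
    have lt_d : ψ y < y d :=
      calc
        ψ y < y (c ⇨ d) ⊓ y c := lt_inf_iff.2 ⟨lt_himp, hc⟩
        _ = y ((c ⇨ d) ⊓ c) := (map_inf y _ _).symm
        _ ≤ y d := OrderHomClass.mono y himp_inf_le
    exact lt_d.not_ge hyd
  have hψ_iff := hψ (by omega) (by omega) (by omega) hψy same_filter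
  exact absurd (hψ_iff.1 hiψ) (Nat.not_succ_le_self _)

theorem yieldsDuality_of_forall_mem {M : AlterEgo n}
    (hH : ∀ i (hi : 1 ≤ i) (hin : i + 3 ≤ n), f i hi hin ∈ M.H ∨ g i hi hin ∈ M.H)
    {j : ℕ} {hj : 1 ≤ j} {hjn : j + 2 ≤ n} (hG : h j hj hjn ∈ M.G) : YieldsDuality.{u} M := by
  intro A _ hA
  refine ⟨evalHom_injective M hA, fun φ => mem_range_evalHom φ fun x y => ?_⟩
  have hg (i hi hin) : Preserves φ.fn (g i hi hin).graph := preserves_graph_g_of_mem φ (hH i hi hin)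
  have hh (k hk hkn) : Preserves φ.fn (Function.graph (h k hk hkn)) :=
    (preserves_graph_h_iff_one hg hk hkn).2
      ((preserves_graph_h_iff_one hg hj hjn).1 (preserves_graph_of_mem_G φ hG))
  exact exists_le_apply_and_apply_le (preserves_le_iff_le hg hh) x y

theorem yieldsDuality_of_mem_Sigma {σ : (Fin (n - 3) → PartialEnd n) × HeytingHom (C n) (C n)}
    (hσ : σ ∈ Sigma n) : YieldsDuality.{u} (alterEgo σ) := by
  obtain ⟨hσ₁, j, hj, hjn, hσ₂⟩ := hσ
  refine yieldsDuality_of_forall_mem (fun i hi hin => ?_) (j := j) (hj := hj) (hjn := hjn) hσ₂.symm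
  obtain ⟨k, rfl⟩ : ∃ k, i = k + 1 := ⟨i - 1, by omega⟩
  exact (hσ₁ ⟨k, by omega⟩).imp (fun hf => ⟨_, hf⟩) (fun hg => ⟨_, hg⟩)

end Interpolation

section Counting

variable {n : ℕ} [NeZero n]

/-- Reads the index `i` off the graph of a member of `{f_i, g_i}`. -/
theorem mem_graph_or_mem_graph_iff {i : ℕ} {hi : 1 ≤ i} {hin : i + 3 ≤ n} {p : PartialEnd n}
    (hp : p = f i hi hin ∨ p = g i hi hin) {k : ℕ} (hk : k + 1 < n) :
    (⟨k, by omega⟩ ~[p.graph] ⟨k + 1, hk⟩ ∨ ⟨k + 1, hk⟩ ~[p.graph] ⟨k, by omega⟩) ↔ k = i := by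
  rcases hp with rfl | rfl
  · rw [mem_graph_f, mem_graph_f]
    grind
  · rw [mem_graph_g, mem_graph_g]
    grind

theorem index_unique {i j : ℕ} {hi : 1 ≤ i} {hin : i + 3 ≤ n} {hj : 1 ≤ j} {hjn : j + 3 ≤ n}
    {p : PartialEnd n} (hp : p = f i hi hin ∨ p = g i hi hin)
    (hp' : p = f j hj hjn ∨ p = g j hj hjn) : i = j :=
  (mem_graph_or_mem_graph_iff hp' (by omega)).1
    ((mem_graph_or_mem_graph_iff hp (by omega)).2 rfl)

theorem f_ne_g {i : ℕ} (hi : 1 ≤ i) (hin : i + 3 ≤ n) : f i hi hin ≠ g i hi hin := by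
  intro hfg
  have hf : ⟨i, by omega⟩ ~[(f i hi hin).graph] ⟨i + 1, by omega⟩ := by
    simp [mem_graph_f]
  rw [hfg, mem_graph_g] at hf
  exact hf.1 rfl

theorem h_inj {i j : ℕ} {hi : 1 ≤ i} {hin : i + 2 ≤ n} {hj : 1 ≤ j} {hjn : j + 2 ≤ n} :
    h (n := n) i hi hin = h j hj hjn ↔ i = j := by
  refine ⟨fun hij => ?_, by rintro rfl; rfl⟩
  have apply_val (u) : (h i hi hin u).val = (h j hj hjn u).val := by rw [hij]
  have hij_i := apply_val ⟨i, by omega⟩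
  have hij_j := apply_val ⟨j, by omega⟩
  rw [h_apply_val, h_apply_val] at hij_i hij_j
  grind

variable (n) in
theorem Sigma_eq_prod : Sigma n =
    (Set.univ.pi fun k : Fin (n - 3) =>
      {f (k.val + 1) (by omega) (by omega), g (k.val + 1) (by omega) (by omega)}) ×ˢ
    Set.range fun j : Fin (n - 2) => h (j.val + 1) (by omega) (by omega) := by
  ext ⟨p, e⟩
  simp only [Sigma, Set.mem_ofPred_eq, Set.mem_prod, Set.mem_univ_pi, Set.mem_insert_iff,
    Set.mem_singleton_iff, Set.mem_range]
  refine and_congr_right fun _ => ⟨?_, ?_⟩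
  · rintro ⟨j, hj, hjn, rfl⟩
    exact ⟨⟨j - 1, by omega⟩, h_inj.2 (Nat.sub_add_cancel hj)⟩
  · rintro ⟨j, rfl⟩
    exact ⟨j + 1, by omega, by omega, rfl⟩

variable (n) in
theorem ncard_Sigma : (Sigma n).ncard = 2 ^ (n - 3) * (n - 2) := by
  rw [Sigma_eq_prod, Set.ncard_prod]
  congr 1
  · rw [Set.ncard, Set.encard_pi_eq_prod_encard]
    simp [Set.encard_pair (f_ne_g _ _)]
  · rw [Set.ncard_range_of_injective, Nat.card_fin]
    exact fun i j hij => Fin.ext (Nat.succ_injective (h_inj.1 hij))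

variable {σ τ : (Fin (n - 3) → PartialEnd n) × HeytingHom (C n) (C n)}

theorem eq_of_fst_apply_eq (hσ : σ ∈ Sigma n) (hτ : τ ∈ Sigma n) {k l : Fin (n - 3)}
    (hkl : σ.1 k = τ.1 l) : k = l :=
  Fin.ext (Nat.succ_injective (index_unique (hσ.1 k) (hkl ▸ hτ.1 l)))

theorem ncard_alterEgo_H (hσ : σ ∈ Sigma n) : (alterEgo σ).H.ncard = n - 3 := by
  rw [alterEgo, Set.ncard_range_of_injective fun _ _ => eq_of_fst_apply_eq hσ hσ, Nat.card_fin]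

theorem injOn_alterEgo : Set.InjOn alterEgo (Sigma n) := by
  intro σ hσ τ hτ hστ
  refine Prod.ext (funext fun k => ?_) (Set.singleton_injective (congrArg AlterEgo.G hστ))
  obtain ⟨l, hl⟩ : σ.1 k ∈ (alterEgo τ).H := hστ ▸ ⟨k, rfl⟩
  rw [← hl, eq_of_fst_apply_eq hσ hτ hl.symm]

theorem ncard_image_alterEgo : (alterEgo '' Sigma n).ncard = 2 ^ (n - 3) * (n - 2) := by
  rw [injOn_alterEgo.ncard_image, ncard_Sigma]

end Counting

end GoedelDuality

theorem theorem3p3 (n : ℕ) [NeZero n] (hn : 4 ≤ n) :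
    (∀ σ ∈ GoedelDuality.Sigma n,
      GoedelDuality.YieldsDuality.{u} (GoedelDuality.alterEgo σ) ∧
      (GoedelDuality.alterEgo σ).H.ncard = n - 3 ∧
      (GoedelDuality.alterEgo σ).G.ncard = 1) ∧
    (GoedelDuality.alterEgo '' GoedelDuality.Sigma n).ncard = 2 ^ (n - 3) * (n - 2) :=
  ⟨fun _ hσ => ⟨GoedelDuality.yieldsDuality_of_mem_Sigma hσ, GoedelDuality.ncard_alterEgo_H hσ,
    Set.ncard_singleton _⟩, GoedelDuality.ncard_image_alterEgo⟩
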